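/- Let $G$ be a countable sofic group. This means that there are maps (not necessarily homomorphisms) $\sigma_i : G \to \mathrm{Sym}(m_i)$, $m_i \ge 1$, increasing subsets $F_1 \subseteq F_2 \subseteq \cdots$ of $G$ with $\bigcup_i F_i = G$, and reals $\epsilon_i \to 0$, such that for every $i$ at least $(1-\epsilon_i) m_i$ of the points $v \in \{1,\dots,m_i\}$ satisfy, for all $f_1, f_2 \in F_i$, both $\sigma_i(f_1)\sigma_i(f_2) v = \sigma_i(f_1 f_2) v$ and $\sigma_i(f_1) v \neq \sigma_i(f_2) v$ if $f_1 \ne f_2$. For a standard Borel probability space $(K,\kappa)$, put $H(\kappa) = -\sum_{k \in K'} \kappa(\{k\}) \log \kappa(\{k\})$ (with $0 \log 0 = 0$) if there is a finite or countably infinite set $K' \subseteq K$ with $\kappa(K') = 1$, and $H(\kappa) = +\infty$ otherwise. The Bernoulli shift $(G, K^G, \kappa^G)$ is the space $K^G$ of all functions $x : G \to K$, with the product measure $\kappa^G$ and the action $(g x)(f) = x(g^{-1} f)$ for $g, f \in G$. Two systems $(G_1, X_1, \mu_1)$ and $(G_2, X_2, \mu_2)$ are conjugate up to automorphisms if there are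 a group isomorphism $\Phi : G_1 \to G_2$, conull sets $X_1' \subseteq X_1$ and $X_2' \subseteq X_2$ with $X_1'$ being $G_1$-invariant, and an isomorphism of measure spaces $\phi : X_1' \to X_2'$ such that $\phi(g x) = \Phi(g)\phi(x)$ for all $g \in G_1$ and $x \in X_1'$. **Theorem.** Let $G$ be a countable sofic group and let $(K_1, \kappa_1)$, $(K_2, \kappa_2)$ be standard Borel probability spaces such that $H(\kappa_1) + H(\kappa_2) < \infty$. If $(G, K_1^G, \kappa_1^G)$ is conjugate up to automorphisms to $(G, K_2^G, \kappa_2^G)$, then $H(\kappa_1) = H(\kappa_2)$. -/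

import Mathlib

open MeasureTheory Filter Topology
open scoped ENNReal

/-! ### Sofic groups -/

/-- For a map `σ : G → Sym(m)` (not assumed to be a homomorphism) and `F ⊆ G`, the set `V(F)` of
all points `v` at which `σ` is multiplicative and free along `F`. -/
def soficGoodSet {G : Type*} [Group G] {m : ℕ} (σ : G → Equiv.Perm (Fin m)) (F : Set G) :
    Set (Fin m) :=
  {v | ∀ f₁ ∈ F, ∀ f₂ ∈ F,
    σ f₁ (σ f₂ v) = σ (f₁ * f₂) v ∧ (f₁ ≠ f₂ → σ f₁ v ≠ σ f₂ v)}

/-- `σ : G → Sym(m)` is an `(F, ε)`-approximation to `G` if `|V(F)| ≥ (1 - ε) m`. -/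
def IsSoficApproxMap {G : Type*} [Group G] {m : ℕ} (σ : G → Equiv.Perm (Fin m)) (F : Set G)
    (ε : ℝ) : Prop :=
  (1 - ε) * (m : ℝ) ≤ ((soficGoodSet σ F).ncard : ℝ)

/-- The sequence `σ i : G → Sym(m i)` is a sofic approximation to `G`: each `σ i` is an
`(F i, ε i)`-approximation, where the sets `F i` increase to `G` and `ε i → 0`. -/
def IsSoficApproximation {G : Type*} [Group G] (m : ℕ → ℕ)
    (σ : ∀ i, G → Equiv.Perm (Fin (m i))) : Prop :=
  (∀ i, 1 ≤ m i) ∧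
  ∃ (F : ℕ → Set G) (ε : ℕ → ℝ),
    (∀ i, F i ⊆ F (i + 1)) ∧ (⋃ i, F i) = Set.univ ∧ Tendsto ε atTop (𝓝 0) ∧
    ∀ i, IsSoficApproxMap (σ i) (F i) (ε i)

/-- A (countable) group is sofic if it admits a sofic approximation. -/
def IsSofic (G : Type*) [Group G] : Prop :=
  ∃ (m : ℕ → ℕ) (σ : ∀ i, G → Equiv.Perm (Fin (m i))), IsSoficApproximation m σ

/-! ### Entropy of a probability measure -/

open Classical in
/-- The entropy `H(κ) ∈ [0, ∞]`: if `κ` is carried by a countable set, it is the sum of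
`- κ{k} log κ{k}` (points outside a countable carrier contribute `0`, see
`baseEntropy_eq_tsum`), and otherwise it is `∞`. -/
noncomputable def baseEntropy {K : Type*} [MeasurableSpace K] (κ : Measure K) : ℝ≥0∞ :=
  if ∃ K' : Set K, K'.Countable ∧ κ K' = 1 then
    ∑' k : K, ENNReal.ofReal (Real.negMulLog (κ.real {k}))
  else ⊤

/-- The entropy may be computed over any countable set of full measure. -/
theorem baseEntropy_eq_tsum {K : Type*} [MeasurableSpace K] [MeasurableSingletonClass K]
    (κ : Measure K) [IsProbabilityMeasure κ] (K' : Set K) (hc : K'.Countable) (h1 : κ K' = 1) :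
    baseEntropy κ = ∑' k : K', ENNReal.ofReal (Real.negMulLog (κ.real {(k : K)})) := by
  have h0 : κ K'ᶜ = 0 := (prob_compl_eq_zero_iff hc.measurableSet).2 h1
  rw [baseEntropy, if_pos ⟨K', hc, h1⟩]
  symm
  refine tsum_subtype_eq_of_support_subset
    (f := fun k : K => ENNReal.ofReal (Real.negMulLog (κ.real {k}))) ?_
  intro k hk
  by_contra hk'
  apply hk
  have : κ {k} = 0 := measure_mono_null (by simpa using hk') h0
  simp [Measure.real, this]

/-! ### Bernoulli shifts -/

/-- The space `K^G` of all functions `G → K`, on which `G` acts by the shift. -/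
def BernoulliSpace (G K : Type*) : Type _ := G → K

/-- The product measurable structure on `K^G`. -/
instance BernoulliSpace.instMeasurableSpace (G K : Type*) [MeasurableSpace K] :
    MeasurableSpace (BernoulliSpace G K) :=
  inferInstanceAs (MeasurableSpace (G → K))

/-- The shift action `(g x)(f) = x (g⁻¹ f)`. -/
instance BernoulliSpace.instMulAction (G K : Type*) [Group G] :
    MulAction G (BernoulliSpace G K) where
  smul g x := fun f => x (g⁻¹ * f)
  one_smul x := by
    funext f
    change x (1⁻¹ * f) = x f
    simp
  mul_smul g h x := by
    funext f
    change x ((g * h)⁻¹ * f) = x (h⁻¹ * (g⁻¹ * f))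
    simp [mul_assoc]

/-- The product measure `κ^G` on `K^G`. -/
noncomputable def bernoulliMeasure (G : Type*) {K : Type*} [MeasurableSpace K] (κ : Measure K)
    [IsProbabilityMeasure κ] : Measure (BernoulliSpace G K) :=
  Measure.infinitePi (fun _ : G => κ)

/-! ### Conjugacy up to automorphisms -/

/-- The systems `(G₁, X₁, μ₁)` and `(G₂, X₂, μ₂)` are conjugate up to automorphisms: there are a
group isomorphism `Φ : G₁ ≃* G₂`, conull sets `X₁' ⊆ X₁`, `X₂' ⊆ X₂` and an isomorphism of
measure spaces `φ : X₁' → X₂'` such that `φ (g x) = Φ(g) φ(x)` for all `g` and all `x ∈ X₁'`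
(in particular `g x ∈ X₁'`). The sets `X₁'`, `X₂'` carry the restricted measures. -/
def ConjugateUpToAutomorphisms (G₁ G₂ : Type*) [Group G₁] [Group G₂] {X₁ X₂ : Type*}
    [MeasurableSpace X₁] [MeasurableSpace X₂] [MulAction G₁ X₁] [MulAction G₂ X₂]
    (μ₁ : Measure X₁) (μ₂ : Measure X₂) : Prop :=
  ∃ (Φ : G₁ ≃* G₂) (X₁' : Set X₁) (X₂' : Set X₂) (φ : X₁' ≃ᵐ X₂'),
    μ₁ X₁'ᶜ = 0 ∧ μ₂ X₂'ᶜ = 0 ∧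
    MeasurePreserving φ (μ₁.comap Subtype.val) (μ₂.comap Subtype.val) ∧
    ∀ (g : G₁) (x : X₁'), ∃ h : g • (x : X₁) ∈ X₁',
      ((φ ⟨g • (x : X₁), h⟩ : X₂') : X₂) = Φ g • ((φ x : X₂') : X₂)

/-!
On a finite sofic model of `G` with `m` points, label the points by independent letters of a finite
partition of `K₁`. The conjugacy records such a configuration as one with letters in a finite
partition `b` of `K₂`, and its inverse recovers the original letters, both through local rules up to
a small error. By Gibbs' inequality the entropy `m * H(a)` of the labelling is at most the cost of
coding the record with independent weights close to the law of `b`, followed by the rare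
corrections; after dividing by `m` this gives `H(a) ≤ H(b) + ε`. The record on the model need not be
i.i.d.; a cross entropy with product weights depends only on its one-point marginals, which is why
it, and not the entropy of the record, is estimated. Smoothing the weights keeps all costs bounded,
so that a bad point of the model, or a wrong value of a local rule, contributes little. Taking
suprema over finite partitions gives `H(κ₁) ≤ H(κ₂)`, and the converse by symmetry.
-/

/-! ### Random variables with finitely many values -/

section FiniteValued

variable {Ω R : Type*} [Finite R]

theorem exists_forall_sub_le_of_finite (u : R → ℝ) : ∃ C, 0 ≤ C ∧ ∀ r s, u r - u s ≤ C := by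
  obtain ⟨C, hC⟩ := Metric.isBounded_range_iff.1 (Set.finite_range u).isBounded
  exact ⟨max C 0, le_max_right _ _, fun r s =>
    (le_abs_self _).trans ((hC r s).trans (le_max_left _ _))⟩

variable [MeasurableSpace Ω] [MeasurableSpace R] [MeasurableSingletonClass R]

theorem integrable_comp_of_finite (P : Measure Ω) [IsFiniteMeasure P] (u : R → ℝ) {Y : Ω → R}
    (hY : Measurable Y) : Integrable (fun ω => u (Y ω)) P :=
  Integrable.comp_measurable .of_finite hY

theorem integral_map_of_finite (P : Measure Ω) [IsFiniteMeasure P] (u : R → ℝ) {Y : Ω → R}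
    (hY : Measurable Y) : ∫ r, u r ∂P.map Y = ∫ ω, u (Y ω) ∂P :=
  integral_map hY.aemeasurable Integrable.of_finite.aestronglyMeasurable

theorem integral_comp_of_measurePreserving {Ω' : Type*} [MeasurableSpace Ω'] {P : Measure Ω}
    {P' : Measure Ω'} [IsFiniteMeasure P'] {f : Ω → Ω'} (hf : MeasurePreserving f P P')
    (u : R → ℝ) {Y : Ω' → R} (hY : Measurable Y) : ∫ ω, u (Y (f ω)) ∂P = ∫ ω, u (Y ω) ∂P' := by
  have h := (integrable_comp_of_finite P' u hY).aestronglyMeasurable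
  rw [← hf.map_eq] at h ⊢
  exact (integral_map hf.aemeasurable h).symm

theorem integral_comp_le_of_forall_le {P : Measure Ω} [IsProbabilityMeasure P] {u : R → ℝ} {β : ℝ}
    (hβ : ∀ r, u r ≤ β) {Y : Ω → R} (hY : Measurable Y) : ∫ ω, u (Y ω) ∂P ≤ β :=
  (integral_mono (integrable_comp_of_finite P u hY) (integrable_const β) fun ω => hβ (Y ω)).trans_eq
    (by simp)

theorem integral_comp_le_add_measureReal_ne (P : Measure Ω) [IsFiniteMeasure P] {u : R → ℝ}
    {C : ℝ} (hC : ∀ r s, u r - u s ≤ C) {Y Y' : Ω → R} (hY : Measurable Y) (hY' : Measurable Y') :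
    ∫ ω, u (Y ω) ∂P ≤ ∫ ω, u (Y' ω) ∂P + C * P.real {ω | Y ω ≠ Y' ω} := by
  have hne : MeasurableSet {ω | Y ω ≠ Y' ω} := (measurableSet_eq_fun hY hY').compl
  calc ∫ ω, u (Y ω) ∂P
      ≤ ∫ ω, (u (Y' ω) + {ω | Y ω ≠ Y' ω}.indicator (fun _ => C) ω) ∂P := by
        refine integral_mono (integrable_comp_of_finite P u hY)
          ((integrable_comp_of_finite P u hY').add ((integrable_const C).indicator hne)) fun ω => ?_
        by_cases h : Y ω = Y' ω
        · simp [h]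
        · simpa [h] using sub_le_iff_le_add'.1 (hC (Y ω) (Y' ω))
    _ = ∫ ω, u (Y' ω) ∂P + C * P.real {ω | Y ω ≠ Y' ω} := by
        rw [integral_add (integrable_comp_of_finite P u hY')
          ((integrable_const C).indicator hne), integral_indicator_const C hne, smul_eq_mul,
          mul_comm]

end FiniteValued

/-! ### Entropy on finite sets -/

theorem negMulLog_le_neg_mul_log_add {p q : ℝ} (hp : 0 ≤ p) (hq : 0 < q) :
    Real.negMulLog p ≤ -(p * Real.log q) + (q - p) := by
  rcases hp.eq_or_lt with rfl | hp
  · simpa using hq.le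
  have hlog : Real.log (q / p) ≤ q / p - 1 := Real.log_le_sub_one_of_pos (div_pos hq hp)
  rw [Real.log_div hq.ne' hp.ne'] at hlog
  have hscaled := mul_le_mul_of_nonneg_left hlog hp.le
  rw [mul_sub, mul_sub, mul_div_cancel₀ _ hp.ne', mul_one] at hscaled
  rw [Real.negMulLog]
  linarith

section FiniteEntropy

variable {A B : Type*} [Fintype A] [MeasurableSpace A] [Fintype B] [MeasurableSpace B]

/-- The Shannon entropy of a measure on a finite set, as a real number. -/
noncomputable def shannonEntropy (μ : Measure A) : ℝ :=
  ∑ a, Real.negMulLog (μ.real {a})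

theorem shannonEntropy_nonneg (μ : Measure A) [IsProbabilityMeasure μ] : 0 ≤ shannonEntropy μ :=
  Finset.sum_nonneg fun _ _ => Real.negMulLog_nonneg measureReal_nonneg measureReal_le_one

theorem ae_measureReal_singleton_pos {A : Type*} [Countable A] [MeasurableSpace A] (μ : Measure A)
    [IsFiniteMeasure μ] :
    ∀ᵐ a ∂μ, 0 < μ.real {a} := by
  rw [ae_iff_of_countable]
  exact fun a ha => ENNReal.toReal_pos ha (measure_ne_top μ _)

variable [MeasurableSingletonClass A] [MeasurableSingletonClass B]

theorem shannonEntropy_eq_integral_neg_log (μ : Measure A) [IsFiniteMeasure μ] :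
    shannonEntropy μ = ∫ a, -Real.log (μ.real {a}) ∂μ := by
  simp only [integral_fintype .of_finite, shannonEntropy, Real.negMulLog, smul_eq_mul, mul_neg,
    neg_mul]

theorem shannonEntropy_le_integral_neg_log (μ : Measure A) [IsProbabilityMeasure μ] {q : A → ℝ}
    (hq : ∀ a, 0 < q a) (hq₁ : ∑ a, q a ≤ 1) :
    shannonEntropy μ ≤ ∫ a, -Real.log (q a) ∂μ := by
  have hμ : ∑ a, μ.real {a} = 1 := by simp
  calc shannonEntropy μ
      ≤ ∑ a, (-(μ.real {a} * Real.log (q a)) + (q a - μ.real {a})) :=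
        Finset.sum_le_sum fun a _ => negMulLog_le_neg_mul_log_add measureReal_nonneg (hq a)
    _ ≤ ∑ a, -(μ.real {a} * Real.log (q a)) := by
        rw [Finset.sum_add_distrib, Finset.sum_sub_distrib, hμ]
        linarith
    _ = ∫ a, -Real.log (q a) ∂μ := by
        simp only [integral_fintype .of_finite, smul_eq_mul, mul_neg]

theorem shannonEntropy_map_le (μ : Measure A) [IsFiniteMeasure μ] (f : A → B) :
    shannonEntropy (μ.map f) ≤ shannonEntropy μ := by
  have hf : Measurable f := measurable_of_finite f
  rw [shannonEntropy_eq_integral_neg_log, shannonEntropy_eq_integral_neg_log,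
    integral_map_of_finite μ _ hf]
  refine integral_mono_ae .of_finite .of_finite ?_
  filter_upwards [ae_measureReal_singleton_pos μ] with a ha
  refine neg_le_neg (Real.log_le_log ha ?_)
  rw [map_measureReal_apply hf (measurableSet_singleton _)]
  exact measureReal_mono (by simp)

theorem shannonEntropy_infinitePi {V : Type*} [Fintype V] [DecidableEq V] (μ : V → Measure A)
    [∀ v, IsProbabilityMeasure (μ v)] :
    shannonEntropy (Measure.infinitePi μ) = ∑ v, shannonEntropy (μ v) := by
  have hpos : ∀ᵐ x ∂Measure.infinitePi μ, ∀ v, 0 < (μ v).real {x v} := ae_all_iff.2 fun v =>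
    (measurePreserving_eval_infinitePi μ v).quasiMeasurePreserving.ae
      (ae_measureReal_singleton_pos (μ v))
  calc shannonEntropy (Measure.infinitePi μ)
      = ∫ x, ∑ v, -Real.log ((μ v).real {x v}) ∂Measure.infinitePi μ := by
        rw [shannonEntropy_eq_integral_neg_log]
        refine integral_congr_ae ?_
        filter_upwards [hpos] with x hx
        rw [Measure.real, Measure.infinitePi_singleton_of_fintype, ENNReal.toReal_prod]
        exact (congrArg Neg.neg (Real.log_prod fun v _ => (hx v).ne')).trans
          (Finset.sum_neg_distrib _).symm
    _ = ∑ v, shannonEntropy (μ v) := by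
        rw [integral_finsetSum _ fun v _ => .of_finite]
        refine Finset.sum_congr rfl fun v _ => ?_
        have heval := integral_map_of_finite (Measure.infinitePi μ)
          (fun a => -Real.log ((μ v).real {a})) (measurable_pi_apply v)
        rw [Measure.infinitePi_map_eval] at heval
        rw [shannonEntropy_eq_integral_neg_log, heval]

end FiniteEntropy

/-! ### Coding costs -/

section Smoothing

variable {A : Type*} [Fintype A]

/-- The mixture of a weight `p` with the uniform distribution in which `p` has mass `exp (-δ)`:
it is bounded away from `0`, and coding with it instead of `p` costs at most `δ` more. -/
noncomputable def smoothing (δ : ℝ) (p : A → ℝ) (a : A) : ℝ :=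
  Real.exp (-δ) * p a + (1 - Real.exp (-δ)) * (Fintype.card A : ℝ)⁻¹

variable {δ : ℝ} {p : A → ℝ}

theorem smoothing_pos (hδ : 0 < δ) (hp : ∀ a, 0 ≤ p a) (a : A) : 0 < smoothing δ p a := by
  have hexp : Real.exp (-δ) < 1 := Real.exp_lt_one_iff.2 (neg_neg_of_pos hδ)
  have hcard : 0 < (Fintype.card A : ℝ) := Nat.cast_pos.2 (Fintype.card_pos_iff.2 ⟨a⟩)
  have := hp a
  have := sub_pos.2 hexp
  rw [smoothing]
  positivity

theorem sum_smoothing_le_one (hδ : 0 ≤ δ) (hp : ∑ a, p a ≤ 1) : ∑ a, smoothing δ p a ≤ 1 := by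
  have hexp : Real.exp (-δ) ≤ 1 := Real.exp_le_one_iff.2 (neg_nonpos.2 hδ)
  calc ∑ a, smoothing δ p a
      = Real.exp (-δ) * ∑ a, p a
          + (1 - Real.exp (-δ)) * (Fintype.card A * (Fintype.card A : ℝ)⁻¹) := by
        simp only [smoothing, Finset.sum_add_distrib, ← Finset.mul_sum, Finset.sum_const,
          Finset.card_univ, nsmul_eq_mul]
    _ ≤ Real.exp (-δ) * 1 + (1 - Real.exp (-δ)) * 1 := by
        have := sub_nonneg.2 hexp
        gcongr
        · exact mul_inv_le_one
    _ = 1 := by ring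

theorem neg_log_smoothing_le (hδ : 0 ≤ δ) {a : A} (ha : 0 < p a) :
    -Real.log (smoothing δ p a) ≤ -Real.log (p a) + δ := by
  have hexp : Real.exp (-δ) ≤ 1 := Real.exp_le_one_iff.2 (neg_nonpos.2 hδ)
  have hle : Real.exp (-δ) * p a ≤ smoothing δ p a :=
    le_add_of_nonneg_right (mul_nonneg (sub_nonneg.2 hexp) (by positivity))
  have hlog := Real.log_le_log (mul_pos (Real.exp_pos _) ha) hle
  rw [Real.log_mul (Real.exp_pos _).ne' ha.ne', Real.log_exp] at hlog
  linarith

theorem integral_neg_log_smoothing_le [MeasurableSpace A] [MeasurableSingletonClass A]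
    (μ : Measure A) [IsProbabilityMeasure μ] (hδ : 0 ≤ δ) :
    ∫ a, -Real.log (smoothing δ (fun a => μ.real {a}) a) ∂μ ≤ shannonEntropy μ + δ := by
  calc ∫ a, -Real.log (smoothing δ (fun a => μ.real {a}) a) ∂μ
      ≤ ∫ a, (-Real.log (μ.real {a}) + δ) ∂μ := by
        refine integral_mono_ae .of_finite .of_finite ?_
        filter_upwards [ae_measureReal_singleton_pos μ] with a ha
        exact neg_log_smoothing_le hδ ha
    _ = shannonEntropy μ + δ := by
        rw [integral_add .of_finite .of_finite, ← shannonEntropy_eq_integral_neg_log]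
        simp

end Smoothing

section CodingCost

/-- The cost, in nats, of recording the letter `b` with the weight `w b` and then the letter `s`
with the weight `ρ t s`, where `t` is a guess for `s`; the argument is `(b, t, s)`. -/
noncomputable def codingCost {A B : Type*} (w : B → ℝ) (ρ : A → A → ℝ) (r : B × A × A) : ℝ :=
  -Real.log (w r.1) - Real.log (ρ r.2.1 r.2.2)

variable {Ω A B V : Type*} [MeasurableSpace Ω] [Fintype V] [DecidableEq V]
  [Fintype A] [Fintype B]

theorem sum_prod_mul_le_one {w : B → ℝ} (hw : ∀ b, 0 ≤ w b) (hw₁ : ∑ b, w b ≤ 1)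
    {ρ : A → A → ℝ} (hρ : ∀ t s, 0 ≤ ρ t s) (hρ₁ : ∀ t, ∑ s, ρ t s ≤ 1) (e : (V → B) → V → A) :
    ∑ z : (V → A) × (V → B), ∏ v, (w (z.2 v) * ρ (e z.2 v) (z.1 v)) ≤ 1 := by
  have hdecode (y : V → B) : ∑ x : V → A, ∏ v, ρ (e y v) (x v) ≤ 1 := by
    rw [← Fintype.prod_sum]
    exact Finset.prod_le_one (fun v _ => Finset.sum_nonneg fun s _ => hρ _ s) fun v _ => hρ₁ _
  calc ∑ z : (V → A) × (V → B), ∏ v, (w (z.2 v) * ρ (e z.2 v) (z.1 v))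
      = ∑ y : V → B, (∏ v, w (y v)) * ∑ x : V → A, ∏ v, ρ (e y v) (x v) := by
        simp only [Fintype.sum_prod_type_right, Finset.prod_mul_distrib, Finset.mul_sum]
    _ ≤ ∑ y : V → B, ∏ v, w (y v) := Finset.sum_le_sum fun y _ =>
        mul_le_of_le_one_right (Finset.prod_nonneg fun v _ => hw _) (hdecode y)
    _ ≤ 1 := by
        rw [← Fintype.prod_sum]
        exact Finset.prod_le_one (fun v _ => Finset.sum_nonneg fun b _ => hw b) fun v _ => hw₁

variable [MeasurableSpace A] [MeasurableSingletonClass A] [MeasurableSpace B]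
  [MeasurableSingletonClass B]

theorem shannonEntropy_map_le_sum_integral (P : Measure Ω) [IsProbabilityMeasure P]
    {X : Ω → V → A} (hX : Measurable X) {Y : Ω → V → B} (hY : Measurable Y)
    {w : B → ℝ} (hw : ∀ b, 0 < w b) (hw₁ : ∑ b, w b ≤ 1)
    {ρ : A → A → ℝ} (hρ : ∀ t s, 0 < ρ t s) (hρ₁ : ∀ t, ∑ s, ρ t s ≤ 1) (e : (V → B) → V → A) :
    shannonEntropy (P.map X) ≤
      ∑ v, ∫ ω, codingCost w ρ (Y ω v, e (Y ω) v, X ω v) ∂P := by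
  have hXY : Measurable fun ω => (X ω, Y ω) := hX.prodMk hY
  have : IsProbabilityMeasure (P.map fun ω => (X ω, Y ω)) :=
    Measure.isProbabilityMeasure_map hXY.aemeasurable
  let q (z : (V → A) × (V → B)) : ℝ := ∏ v, (w (z.2 v) * ρ (e z.2 v) (z.1 v))
  have hq (z) : 0 < q z := Finset.prod_pos fun v _ => mul_pos (hw _) (hρ _ _)
  calc shannonEntropy (P.map X)
      = shannonEntropy ((P.map fun ω => (X ω, Y ω)).map Prod.fst) := by
        rw [Measure.map_map measurable_fst hXY]
        rfl
    _ ≤ shannonEntropy (P.map fun ω => (X ω, Y ω)) := shannonEntropy_map_le _ _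
    _ ≤ ∫ z, -Real.log (q z) ∂P.map fun ω => (X ω, Y ω) :=
        shannonEntropy_le_integral_neg_log _ hq
          (sum_prod_mul_le_one (fun b => (hw b).le) hw₁ (fun t s => (hρ t s).le) hρ₁ e)
    _ = ∫ ω, ∑ v, codingCost w ρ (Y ω v, e (Y ω) v, X ω v) ∂P := by
        rw [integral_map_of_finite P _ hXY]
        refine integral_congr_ae (.of_forall fun ω => ?_)
        simp only [q]
        rw [Real.log_prod fun v _ => (mul_pos (hw _) (hρ _ _)).ne', ← Finset.sum_neg_distrib]
        refine Finset.sum_congr rfl fun v _ => ?_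
        rw [Real.log_mul (hw _).ne' (hρ _ _).ne', neg_add', codingCost]
    _ = ∑ v, ∫ ω, codingCost w ρ (Y ω v, e (Y ω) v, X ω v) ∂P :=
        integral_finsetSum _ fun v _ => integrable_comp_of_finite P
          (fun z => codingCost w ρ (z.2 v, e z.2 v, z.1 v)) hXY

end CodingCost

/-! ### Block codes over a group and over its sofic models -/

section BlockCode

variable {V G K L : Type*}

/-- The block code with local rule `c`: the letter that it writes at `v` is read off from the
pattern of `x` around `v`, where `τ v g` is the point that plays the role of `v * g`. Over `G`
itself `τ` is the multiplication. -/
def blockCode (τ : V → G → V) (c : (G → K) → L) (x : V → K) (v : V) : L :=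
  c fun g => x (τ v g)

theorem measurable_blockCode [MeasurableSpace K] [MeasurableSpace L] (τ : V → G → V)
    {c : (G → K) → L} (hc : Measurable c) : Measurable (blockCode τ c) :=
  measurable_pi_lambda _ fun v => hc.comp (measurable_pi_lambda _ fun g =>
    measurable_pi_apply (τ v g))

theorem map_comp_infinitePi_of_injOn [MeasurableSpace K] [MeasurableSpace L] (κ : Measure K)
    [IsProbabilityMeasure κ] {c : (G → K) → L} (hc : Measurable c) {S : Set G}
    (hS : DependsOn c S) {j : G → V} (hj : S.InjOn j) :
    (Measure.infinitePi fun _ : V => κ).map (fun x => c fun g => x (j g)) =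
      (Measure.infinitePi fun _ : G => κ).map c := by
  classical
  obtain ⟨k₀⟩ : Nonempty K := nonempty_of_isProbabilityMeasure κ
  let extend (z : S → K) (g : G) : K := if h : g ∈ S then z ⟨g, h⟩ else k₀
  have hextend : Measurable extend := measurable_pi_lambda _ fun g => by
    by_cases h : g ∈ S
    · simpa only [extend, dif_pos h] using measurable_pi_apply _
    · simp only [extend, dif_neg h, measurable_const]
  have hcj : (fun x : V → K => c fun g => x (j g)) = (c ∘ extend) ∘ fun x (s : S) => x (j s) :=
    funext fun x => hS fun g hg => by simp only [extend, dif_pos hg]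
  have hcS : c = (c ∘ extend) ∘ fun x (s : S) => x s :=
    funext fun x => hS fun g hg => by simp only [extend, dif_pos hg]
  rw [hcj, ← Measure.map_map (hc.comp hextend) (by fun_prop),
    Measure.map_infinitePi_infinitePi_of_inj (f := fun s : S => j s) hj.injective]
  conv_rhs => rw [hcS]
  rw [← Measure.map_map (hc.comp hextend) (by fun_prop),
    Measure.map_infinitePi_infinitePi_of_inj Subtype.val_injective]

end BlockCode

open scoped Pointwise

section SoficModel

variable {G : Type*} [Group G]

theorem soficGoodSet_anti {m : ℕ} (σ : G → Equiv.Perm (Fin m)) {E F : Set G} (h : E ⊆ F) :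
    soficGoodSet σ F ⊆ soficGoodSet σ E :=
  fun _ hv f₁ h₁ f₂ h₂ => hv f₁ (h h₁) f₂ (h h₂)

theorem IsSoficApproxMap.mono {m : ℕ} {σ : G → Equiv.Perm (Fin m)} {E F : Set G} {δ ε : ℝ}
    (hσ : IsSoficApproxMap σ F δ) (h : E ⊆ F) (hδ : δ ≤ ε) : IsSoficApproxMap σ E ε := by
  calc (1 - ε) * (m : ℝ) ≤ (1 - δ) * m := by gcongr
    _ ≤ (soficGoodSet σ F).ncard := hσ
    _ ≤ (soficGoodSet σ E).ncard :=
      Nat.cast_le.2 (Set.ncard_le_ncard (soficGoodSet_anti σ h) (Set.toFinite _))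

theorem IsSofic.exists_isSoficApproxMap (hG : IsSofic G) {F : Set G} (hF : F.Finite) {ε : ℝ}
    (hε : 0 < ε) :
    ∃ m, 0 < m ∧ ∃ σ : G → Equiv.Perm (Fin m), IsSoficApproxMap σ F ε := by
  obtain ⟨m, σ, hm, E, δ, hE, hEuniv, hδ, hσ⟩ := hG
  have hmono : Monotone E := monotone_nat_of_le_succ hE
  have hFE : ∀ᶠ i in atTop, F ⊆ E i := (eventually_all_finite hF).2 fun f _ => by
    obtain ⟨i, hi⟩ := Set.mem_iUnion.1 (hEuniv ▸ Set.mem_univ f)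
    exact eventually_atTop.2 ⟨i, fun j hij => hmono hij hi⟩
  obtain ⟨i, hi, hδi⟩ := (hFE.and (hδ.eventually_le_const hε)).exists
  exact ⟨m i, hm i, σ i, (hσ i).mono hi hδi⟩

variable {m : ℕ} {σ : G → Equiv.Perm (Fin m)} {F : Set G} {v : Fin m}

/-- The point of the sofic model `σ` that plays the role of `v * g`. Permutations act on the left,
whence the inverse. -/
def soficTranslate (σ : G → Equiv.Perm (Fin m)) (v : Fin m) (g : G) : Fin m :=
  σ g⁻¹ v

theorem injOn_soficTranslate (hv : v ∈ soficGoodSet σ F) : F⁻¹.InjOn (soficTranslate σ v) :=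
  fun g hg h hh hgh => by
    by_contra hne
    exact (hv g⁻¹ hg h⁻¹ hh).2 (inv_injective.ne hne) hgh

theorem soficTranslate_one (hv : v ∈ soficGoodSet σ F) (h1 : 1 ∈ F) : soficTranslate σ v 1 = v := by
  have h := (hv 1 h1 1 h1).1
  rw [one_mul] at h
  rw [soficTranslate, inv_one]
  exact (σ 1).injective h

theorem soficTranslate_soficTranslate (hv : v ∈ soficGoodSet σ F) {g h : G} (hg : g ∈ F⁻¹)
    (hh : h ∈ F⁻¹) : soficTranslate σ (soficTranslate σ v g) h = soficTranslate σ v (g * h) := by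
  rw [soficTranslate, soficTranslate, soficTranslate, mul_inv_rev]
  exact (hv h⁻¹ hh g⁻¹ hg).1

theorem blockCode_blockCode_soficTranslate {K L L' : Type*} (hv : v ∈ soficGoodSet σ F)
    {c : (G → K) → L} {W : Set G} (hc : DependsOn c W) (hW : W ⊆ F⁻¹)
    {d : (G → L) → L'} {T : Set G} (hd : DependsOn d T) (hT : T ⊆ F⁻¹) (x : Fin m → K) :
    blockCode (soficTranslate σ) d (blockCode (soficTranslate σ) c x) v =
      d (blockCode (· * ·) c fun g => x (soficTranslate σ v g)) :=
  hd fun _ hg => hc fun _ hh =>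
    congrArg x (soficTranslate_soficTranslate hv (hT hg) (hW hh))

theorem sum_le_of_isSoficApproxMap {ε : ℝ} (hσ : IsSoficApproxMap σ F ε) {φ : Fin m → ℝ} {α β : ℝ}
    (hα : ∀ v ∈ soficGoodSet σ F, φ v ≤ α) (hβ : ∀ v, φ v ≤ β) (hαβ : α ≤ β) :
    ∑ v, φ v ≤ m * (α + ε * (β - α)) := by
  classical
  have hbad : ((soficGoodSet σ F)ᶜ.ncard : ℝ) ≤ ε * m := by
    have hcard : ((soficGoodSet σ F).ncard : ℝ) + (soficGoodSet σ F)ᶜ.ncard = m := by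
      exact_mod_cast (Set.ncard_add_ncard_compl _).trans (Nat.card_fin m)
    have : (1 - ε) * (m : ℝ) ≤ (soficGoodSet σ F).ncard := hσ
    linarith
  calc ∑ v, φ v
      ≤ ∑ v, (α + (soficGoodSet σ F)ᶜ.indicator (fun _ => β - α) v) :=
        Finset.sum_le_sum fun v _ => by
          by_cases hv : v ∈ soficGoodSet σ F
          · simpa [hv] using hα v hv
          · simpa [hv] using hβ v
    _ = m * α + (soficGoodSet σ F)ᶜ.ncard * (β - α) := by
        rw [Finset.sum_add_distrib, Finset.sum_indicator_eq_sum_filter, Finset.sum_const,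
          Finset.sum_const, Finset.card_fin, nsmul_eq_mul, nsmul_eq_mul, ← Set.ncard_coe_finset,
          Finset.coe_filter_univ, Set.ofPred_mem_eq]
    _ ≤ m * α + ε * m * (β - α) := by
        have := sub_nonneg.2 hαβ
        gcongr
    _ = m * (α + ε * (β - α)) := by ring

end SoficModel

section CodingRecord

variable {G K A B : Type*} [Group G] {a : K → A} {c : (G → K) → B} {d : (G → B) → A}

/-- What happens at `1` when the configuration `z` is recorded through the block code `c` and
recovered through the block code `d`: the recorded letter, the recovered letter, and the letter
`a (z 1)` that was to be recovered. -/
def codingRecord (a : K → A) (c : (G → K) → B) (d : (G → B) → A) (z : G → K) : B × A × A :=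
  (c z, d (blockCode (· * ·) c z), a (z 1))

theorem measurable_codingRecord [MeasurableSpace K] [MeasurableSpace A] [MeasurableSpace B]
    (ha : Measurable a) (hc : Measurable c) (hd : Measurable d) :
    Measurable (codingRecord a c d) :=
  hc.prodMk ((hd.comp (measurable_blockCode _ hc)).prodMk (ha.comp (measurable_pi_apply 1)))

theorem dependsOn_codingRecord {W T : Set G} (hc : DependsOn c W) (hd : DependsOn d T) :
    DependsOn (codingRecord a c d) ({1} ∪ T ∪ W ∪ T * W) := fun z z' h => by
  have hz : z 1 = z' 1 := h 1 (by simp)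
  have hcz : c z = c z' := hc fun g hg => h g (by simp [hg])
  have hdz : d (blockCode (· * ·) c z) = d (blockCode (· * ·) c z') :=
    hd fun g hg => hc fun k hk => h (g * k) (.inr (Set.mul_mem_mul hg hk))
  rw [codingRecord, codingRecord, hz, hcz, hdz]

end CodingRecord

section SoficCoding

variable {V G K A B : Type*} [MeasurableSpace K] (κ : Measure K) [IsProbabilityMeasure κ]
  [MeasurableSpace A] [MeasurableSingletonClass A] [MeasurableSpace B] [MeasurableSingletonClass B]
  {a : K → A} {c : (G → K) → B} {d : (G → B) → A}

theorem integral_blockCode_soficTranslate [Group G] [Finite A] [Finite B]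
    (ha : Measurable a) (hc : Measurable c) (hd : Measurable d) {W T : Set G}
    (hcW : DependsOn c W) (hdT : DependsOn d T) {m : ℕ} {σ : G → Equiv.Perm (Fin m)} {v : Fin m}
    (hv : v ∈ soficGoodSet σ ({1} ∪ T ∪ W ∪ T * W)⁻¹) (u : B × A × A → ℝ) :
    ∫ x, u (blockCode (soficTranslate σ) c x v,
        blockCode (soficTranslate σ) d (blockCode (soficTranslate σ) c x) v, a (x v))
        ∂Measure.infinitePi (fun _ : Fin m => κ) =
      ∫ z, u (codingRecord a c d z) ∂Measure.infinitePi (fun _ : G => κ) := by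
  have hrecord := measurable_codingRecord ha hc hd
  have hlocal (x : Fin m → K) : (blockCode (soficTranslate σ) c x v,
      blockCode (soficTranslate σ) d (blockCode (soficTranslate σ) c x) v, a (x v)) =
      codingRecord a c d fun g => x (soficTranslate σ v g) := by
    have hone : soficTranslate σ v 1 = v := soficTranslate_one hv (by simp)
    rw [blockCode_blockCode_soficTranslate hv hcW (fun _ h => by simp_all) hdT
      (fun _ h => by simp_all), codingRecord, hone]
    rfl
  simp only [hlocal]
  rw [← integral_map_of_finite _ u hrecord, ← map_comp_infinitePi_of_injOn κ hrecord
    (dependsOn_codingRecord hcW hdT) (j := soficTranslate σ v)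
    (by simpa using injOn_soficTranslate hv), integral_map_of_finite _ u (by fun_prop)]

variable [Fintype A] [Fintype B] {w : B → ℝ} {ρ : A → A → ℝ}

theorem card_mul_shannonEntropy_map_le [Fintype V] (τ : V → G → V) (ha : Measurable a)
    (hc : Measurable c) (hw : ∀ b, 0 < w b) (hw₁ : ∑ b, w b ≤ 1) (hρ : ∀ t s, 0 < ρ t s)
    (hρ₁ : ∀ t, ∑ s, ρ t s ≤ 1) (d : (G → B) → A) :
    Fintype.card V * shannonEntropy (κ.map a) ≤
      ∑ v, ∫ x, codingCost w ρ
        (blockCode τ c x v, blockCode τ d (blockCode τ c x) v, a (x v))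
        ∂Measure.infinitePi fun _ : V => κ := by
  classical
  have := Measure.isProbabilityMeasure_map (μ := κ) ha.aemeasurable
  have hiid : shannonEntropy ((Measure.infinitePi fun _ : V => κ).map fun x v => a (x v)) =
      Fintype.card V * shannonEntropy (κ.map a) := by
    rw [Measure.infinitePi_map_pi (f := fun _ : V => a) _ fun _ => ha, shannonEntropy_infinitePi,
      Finset.sum_const, Finset.card_univ, nsmul_eq_mul]
  rw [← hiid]
  exact shannonEntropy_map_le_sum_integral _ (by fun_prop) (measurable_blockCode τ hc) hw hw₁ hρ hρ₁
    (blockCode τ d)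

/-- At almost all points a sofic model looks like `G`, so an i.i.d. configuration on the model is
coded at the cost per point of the coding over `G`. -/
theorem IsSofic.shannonEntropy_map_le_integral_of_dependsOn [Group G] (hG : IsSofic G)
    (ha : Measurable a) (hc : Measurable c) {W : Set G} (hcW : DependsOn c W) (hW : W.Finite)
    (hd : Measurable d) {T : Set G} (hdT : DependsOn d T) (hT : T.Finite)
    (hw : ∀ b, 0 < w b) (hw₁ : ∑ b, w b ≤ 1)
    (hρ : ∀ t s, 0 < ρ t s) (hρ₁ : ∀ t, ∑ s, ρ t s ≤ 1) :
    shannonEntropy (κ.map a) ≤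
      ∫ z, codingCost w ρ (codingRecord a c d z) ∂Measure.infinitePi fun _ : G => κ := by
  set α := ∫ z, codingCost w ρ (codingRecord a c d z) ∂Measure.infinitePi fun _ : G => κ
  obtain ⟨β, hβ⟩ : ∃ β, ∀ r, codingCost w ρ r ≤ β :=
    (Set.finite_range (codingCost w ρ)).bddAbove.imp fun _ h r => h ⟨r, rfl⟩
  have hαβ : α ≤ β := integral_comp_le_of_forall_le hβ (measurable_codingRecord ha hc hd)
  suffices h : ∀ ε > 0, shannonEntropy (κ.map a) ≤ α + ε * (β - α) by
    have hlim : Tendsto (fun ε => α + ε * (β - α)) (𝓝[>] 0) (𝓝 α) :=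
      (Continuous.tendsto' (by fun_prop) _ _ (by ring)).mono_left nhdsWithin_le_nhds
    exact ge_of_tendsto hlim (eventually_mem_nhdsWithin.mono h)
  intro ε hε
  have hS : ({1} ∪ T ∪ W ∪ T * W).Finite :=
    (((Set.finite_singleton 1).union hT).union hW).union (hT.mul hW)
  obtain ⟨m, hm, σ, hσ⟩ := hG.exists_isSoficApproxMap hS.inv hε
  have hcodeσ : Measurable (blockCode (soficTranslate σ) c) := measurable_blockCode _ hc
  have hdσ : Measurable (blockCode (soficTranslate σ) d) := measurable_blockCode _ hd
  have hcard := card_mul_shannonEntropy_map_le κ (soficTranslate σ) ha hc hw hw₁ hρ hρ₁ d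
  rw [Fintype.card_fin] at hcard
  refine le_of_mul_le_mul_left (hcard.trans ?_) (Nat.cast_pos.2 hm)
  exact sum_le_of_isSoficApproxMap hσ
    (fun v hv => (integral_blockCode_soficTranslate κ ha hc hd hcW hdT hv _).le)
    (fun v => integral_comp_le_of_forall_le hβ (by fun_prop)) hαβ

end SoficCoding

/-! ### Finite approximation of random variables -/

section Approximation

theorem isSetAlgebra_setOf_exists_measurableSet {Ω J : Type*} [Nonempty J]
    {ℱ : J → MeasurableSpace Ω} (hℱ : Directed (· ≤ ·) ℱ) :
    IsSetAlgebra {s : Set Ω | ∃ j, MeasurableSet[ℱ j] s} where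
  empty_mem := ⟨Classical.arbitrary J, @MeasurableSet.empty _ (ℱ _)⟩
  compl_mem := fun _ ⟨j, hs⟩ => ⟨j, @MeasurableSet.compl _ _ (ℱ j) hs⟩
  union_mem := fun _ _ ⟨j, hs⟩ ⟨k, ht⟩ => by
    obtain ⟨l, hj, hk⟩ := hℱ j k
    exact ⟨l, @MeasurableSet.union _ (ℱ l) _ _ (hj _ hs) (hk _ ht)⟩

theorem exists_measurable_ne_subset_iUnion_symmDiff {Ω A : Type*} {m : MeasurableSpace Ω} [Finite A]
    [Nonempty A] [MeasurableSpace A] {t : A → Set Ω} (ht : ∀ a, MeasurableSet (t a)) (g : Ω → A) :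
    ∃ c : Ω → A, Measurable c ∧ {x | c x ≠ g x} ⊆ ⋃ a, symmDiff (g ⁻¹' {a}) (t a) := by
  let c (x : Ω) : A := Function.invFun (fun a : A => ({a} : Set A)) {a | x ∈ t a}
  have hset : Measurable fun x => {a | x ∈ t a} :=
    measurable_set_iff.2 fun a => measurable_mem.2 (ht a)
  refine ⟨c, (measurable_of_finite (Function.invFun fun a : A => ({a} : Set A))).comp hset,
    fun x hx => ?_⟩
  by_contra hnot
  simp only [Set.mem_iUnion, not_exists, Set.mem_symmDiff, Set.mem_preimage,
    Set.mem_singleton_iff, not_or, not_and, not_not] at hnot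
  have hxt : {a | x ∈ t a} = {g x} :=
    Set.ext fun a => ⟨fun h => ((hnot a).2 h).symm, fun h => (hnot a).1 h.symm⟩
  refine hx ?_
  simp only [c, hxt]
  exact Function.leftInverse_invFun Set.singleton_injective (g x)

theorem exists_measurable_measureReal_ne_lt {Ω A J : Type*} [MeasurableSpace Ω] (μ : Measure Ω)
    [IsFiniteMeasure μ] [Finite A] [Nonempty A] [MeasurableSpace A] [MeasurableSingletonClass A]
    [Nonempty J] {ℱ : J → MeasurableSpace Ω} (hℱ : Directed (· ≤ ·) ℱ)
    (hsup : ⨆ j, ℱ j = ‹MeasurableSpace Ω›) {g : Ω → A} (hg : Measurable g) {ε : ℝ}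
    (hε : 0 < ε) :
    ∃ (j : J) (c : Ω → A), Measurable[ℱ j] c ∧ μ.real {x | c x ≠ g x} < ε := by
  cases nonempty_fintype A
  have hgen : ‹MeasurableSpace Ω› =
      MeasurableSpace.generateFrom {s | ∃ j, MeasurableSet[ℱ j] s} := by
    rw [← hsup, ← MeasurableSpace.generateFrom_iUnion_measurableSet]
    exact congrArg _ (Set.ext fun s => by simp only [Set.mem_iUnion, Set.mem_ofPred_eq])
  have hdense := Measure.MeasureDense.of_generateFrom_isSetAlgebra_finite μ
    (isSetAlgebra_setOf_exists_measurableSet hℱ) hgen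
  have hε' : 0 < ε / Fintype.card A := div_pos hε (Nat.cast_pos.2 Fintype.card_pos)
  choose t ht hgt using fun a : A => hdense.approx _ (hg (measurableSet_singleton a))
    (measure_ne_top _ _) _ hε'
  choose i hi using ht
  obtain ⟨j, hij⟩ := hℱ.finite_le i
  obtain ⟨c, hc, hcg⟩ := exists_measurable_ne_subset_iUnion_symmDiff (m := ℱ j)
    (fun a => hij a _ (hi a)) g
  refine ⟨j, c, hc, ?_⟩
  calc μ.real {x | c x ≠ g x}
      ≤ μ.real (⋃ a, symmDiff (g ⁻¹' {a}) (t a)) := measureReal_mono hcg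
    _ ≤ ∑ a, μ.real (symmDiff (g ⁻¹' {a}) (t a)) := measureReal_iUnion_fintype_le _
    _ < ∑ _a : A, ε / Fintype.card A :=
        Finset.sum_lt_sum_of_nonempty Finset.univ_nonempty fun a _ =>
          (ENNReal.lt_ofReal_iff_toReal_lt (measure_ne_top _ _)).1 (hgt a)
    _ = ε := by
        rw [Finset.sum_const, Finset.card_univ, nsmul_eq_mul]
        field_simp

variable {ι K : Type*} [MeasurableSpace K]

/-- The σ-algebra on `ι → K` generated by the events `x i ∈ s` with `i` in the finite set `p.1` and
`s` in the finite family `p.2` of measurable sets. -/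
@[reducible]
def finiteEvents (p : Finset ι × Finset {s : Set K // MeasurableSet s}) : MeasurableSpace (ι → K) :=
  MeasurableSpace.comap (fun x (i : p.1) (s : p.2) => x i ∈ s.1.1) inferInstance

theorem monotone_finiteEvents : Monotone (finiteEvents (ι := ι) (K := K)) := by
  rintro ⟨T, 𝒮⟩ ⟨T', 𝒮'⟩ ⟨hT, h𝒮⟩
  rw [finiteEvents, ← measurable_iff_comap_le]
  let _ := finiteEvents (T', 𝒮')
  have h : Measurable fun (x : ι → K) (i : T') (s : 𝒮') => x i ∈ s.1.1 := comap_measurable _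
  exact measurable_pi_lambda _ fun i => measurable_pi_lambda _ fun s =>
    measurable_pi_iff.1 (measurable_pi_iff.1 h ⟨i, hT i.2⟩) ⟨s, h𝒮 s.2⟩

theorem iSup_finiteEvents : ⨆ p, finiteEvents (ι := ι) (K := K) p = MeasurableSpace.pi := by
  refine le_antisymm (iSup_le fun p => ?_) (iSup_le fun i => ?_)
  · rw [finiteEvents, ← measurable_iff_comap_le]
    exact measurable_pi_lambda _ fun i => measurable_pi_lambda _ fun s =>
      (measurable_mem.2 s.1.2).comp (measurable_pi_apply i.1)
  · rintro _ ⟨s, hs, rfl⟩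
    let p : Finset ι × Finset {s : Set K // MeasurableSet s} := ({i}, {⟨s, hs⟩})
    refine le_iSup finiteEvents p _ ?_
    let _ := finiteEvents p
    have h : Measurable fun (x : ι → K) (i : p.1) (s : p.2) => x i ∈ s.1.1 := comap_measurable _
    exact measurableSet_setOfPred.2 (measurable_pi_iff.1 (measurable_pi_iff.1 h
      ⟨i, Finset.mem_singleton_self i⟩) ⟨⟨s, hs⟩, Finset.mem_singleton_self _⟩)

theorem exists_finite_letters_measureReal_ne_lt {A : Type*} (μ : Measure (ι → K))
    [IsProbabilityMeasure μ] [Finite A] [MeasurableSpace A] [MeasurableSingletonClass A]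
    {g : (ι → K) → A} (hg : Measurable g) {ε : ℝ} (hε : 0 < ε) :
    ∃ (n : ℕ) (b : K → Fin n) (T : Finset ι) (d : (ι → Fin n) → A), Measurable b ∧ Measurable d ∧
      DependsOn d (T : Set ι) ∧ μ.real {x | d (fun i => b (x i)) ≠ g x} < ε := by
  classical
  have : Nonempty A := (nonempty_of_isProbabilityMeasure μ).map g
  obtain ⟨⟨T, 𝒮⟩, c, hc, hcg⟩ := exists_measurable_measureReal_ne_lt μ
    monotone_finiteEvents.directed_le iSup_finiteEvents hg hε
  obtain ⟨h, rfl⟩ := (Function.factorsThrough_iff _).1 hc.factorsThrough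
  let label (k : K) (s : 𝒮) : Prop := k ∈ s.1.1
  let e := Finite.equivFin (𝒮 → Prop)
  refine ⟨_, fun k => e (label k), T, fun y => h fun i => e.symm (y i), ?_, ?_, ?_, ?_⟩
  · exact (measurable_of_finite e).comp (measurable_pi_lambda _ fun s =>
      measurable_mem.2 s.1.2)
  · exact (measurable_of_finite fun y : T → Fin _ => h fun i => e.symm (y i)).comp (by fun_prop)
  · exact fun y z hyz => congrArg h (funext fun i => congrArg e.symm (hyz i i.2))
  · simpa only [Equiv.symm_apply_apply, label, Function.comp_apply] using hcg

end Approximation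

/-! ### Conjugate Bernoulli shifts -/

section Conjugacy

theorem measurePreserving_subtype_val_of_compl_null {X : Type*} [MeasurableSpace X] {μ : Measure X}
    {s : Set X} (hs : μ sᶜ = 0) :
    MeasurePreserving (Subtype.val : s → X) (μ.comap Subtype.val) μ where
  measurable := measurable_subtype_coe
  map_eq := Measure.ext fun t ht => by
    have hs' : NullMeasurableSet s μ := NullMeasurableSet.of_compl (.of_null hs)
    rw [Measure.map_apply measurable_subtype_coe ht,
      Measure.comap_apply₀ _ _ Subtype.val_injective
        (fun _ => Measure.MeasurableSet.nullMeasurableSet_subtype_coe hs')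
        (measurable_subtype_coe ht).nullMeasurableSet,
      Subtype.image_preimage_coe, Set.inter_comm, measure_inter_conull hs]

theorem exists_measurable_ae_eq_of_compl_null {X Y : Type*} [MeasurableSpace X] [MeasurableSpace Y]
    [Nonempty Y] {μ : Measure X} {s : Set X} (hs : μ sᶜ = 0) {f : s → Y} (hf : Measurable f) :
    ∃ F : X → Y, Measurable F ∧ ∀ᵐ x ∂μ, ∀ h : x ∈ s, F x = f ⟨x, h⟩ := by
  obtain ⟨N, hsN, hN, hN0⟩ := exists_measurable_superset_of_null hs
  have hNs : Nᶜ ⊆ s := Set.compl_subset_comm.1 hsN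
  obtain ⟨F, hF, hFf⟩ := (MeasurableEmbedding.subtype_coe hN.compl).exists_measurable_extend
    (hf.comp (measurable_inclusion hNs)) fun _ => inferInstance
  refine ⟨F, hF, ?_⟩
  filter_upwards [compl_mem_ae_iff.2 hN0] with x hx _ using congrFun hFf ⟨x, hx⟩

theorem ConjugateUpToAutomorphisms.symm {G₁ G₂ X₁ X₂ : Type*} [Group G₁] [Group G₂]
    [MeasurableSpace X₁] [MeasurableSpace X₂] [MulAction G₁ X₁] [MulAction G₂ X₂]
    {μ₁ : Measure X₁} {μ₂ : Measure X₂} (h : ConjugateUpToAutomorphisms G₁ G₂ μ₁ μ₂) :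
    ConjugateUpToAutomorphisms G₂ G₁ μ₂ μ₁ := by
  obtain ⟨Φ, X₁', X₂', φ, h₁, h₂, hφ, hequiv⟩ := h
  refine ⟨Φ.symm, X₂', X₁', φ.symm, h₂, h₁, hφ.symm φ, fun g y => ?_⟩
  obtain ⟨hx, hgy⟩ := hequiv (Φ.symm g) (φ.symm y)
  rw [Φ.apply_symm_apply, φ.apply_symm_apply] at hgy
  have hmem : g • (y : X₂) ∈ X₂' := hgy ▸ Subtype.coe_prop _
  refine ⟨hmem, ?_⟩
  rw [show (⟨g • (y : X₂), hmem⟩ : X₂') = φ ⟨Φ.symm g • (φ.symm y : X₁), hx⟩ from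
    Subtype.ext hgy.symm, φ.symm_apply_apply]

theorem ConjugateUpToAutomorphisms.exists_measurePreserving {G₁ G₂ X₁ X₂ : Type*} [Group G₁]
    [Group G₂] [MeasurableSpace X₁] [MeasurableSpace X₂] [MulAction G₁ X₁] [MulAction G₂ X₂]
    [Nonempty X₁] [Nonempty X₂] {μ₁ : Measure X₁} {μ₂ : Measure X₂}
    (hinv : ∀ g : G₁, MeasurePreserving (fun x : X₁ => g • x) μ₁ μ₁)
    (h : ConjugateUpToAutomorphisms G₁ G₂ μ₁ μ₂) :
    ∃ (Φ : G₁ ≃* G₂) (E : X₁ → X₂) (J : X₂ → X₁), MeasurePreserving E μ₁ μ₂ ∧ Measurable J ∧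
      (∀ g, ∀ᵐ x ∂μ₁, E (g • x) = Φ g • E x) ∧ ∀ᵐ x ∂μ₁, J (E x) = x := by
  obtain ⟨Φ, X₁', X₂', φ, h₁, h₂, hφ, hequiv⟩ := h
  obtain ⟨E, hE, hEφ⟩ := exists_measurable_ae_eq_of_compl_null h₁
    (measurable_subtype_coe.comp φ.measurable)
  obtain ⟨J, hJ, hJφ⟩ := exists_measurable_ae_eq_of_compl_null h₂
    (measurable_subtype_coe.comp φ.symm.measurable)
  have hX₁' : ∀ᵐ x ∂μ₁, x ∈ X₁' := mem_ae_iff.2 h₁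
  have hval₁ := measurePreserving_subtype_val_of_compl_null h₁
  have hEmp : MeasurePreserving E μ₁ μ₂ := by
    have hae : E ∘ Subtype.val =ᵐ[μ₁.comap Subtype.val] Subtype.val ∘ φ := by
      filter_upwards [hval₁.quasiMeasurePreserving.ae hEφ] with x hx using hx x.2
    refine ⟨hE, ?_⟩
    rw [← hval₁.map_eq, Measure.map_map hE hval₁.measurable, Measure.map_congr hae]
    exact ((measurePreserving_subtype_val_of_compl_null h₂).comp hφ).map_eq
  refine ⟨Φ, E, J, hEmp, hJ, fun g => ?_, ?_⟩
  · filter_upwards [hX₁', hEφ, (hinv g).quasiMeasurePreserving.ae hEφ] with x hx hEx hEgx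
    obtain ⟨hgx, hφgx⟩ := hequiv g ⟨x, hx⟩
    rw [hEgx hgx, hEx hx]
    exact hφgx
  · filter_upwards [hX₁', hEφ, hEmp.quasiMeasurePreserving.ae hJφ] with x hx hEx hJEx
    have hmem : E x ∈ X₂' := hEx hx ▸ Subtype.coe_prop _
    rw [hJEx hmem, Function.comp_apply, show (⟨E x, hmem⟩ : X₂') = φ ⟨x, hx⟩ from
      Subtype.ext (hEx hx), φ.symm_apply_apply]

variable {G K K₁ K₂ : Type*} [Group G] [MeasurableSpace K] [MeasurableSpace K₁]
  [MeasurableSpace K₂]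

theorem measurePreserving_comp_infinitePi (κ : Measure K) [IsProbabilityMeasure κ] {ι ι' : Type*}
    {j : ι' → ι} (hj : j.Injective) :
    MeasurePreserving (fun (x : ι → K) i => x (j i)) (Measure.infinitePi fun _ => κ)
      (Measure.infinitePi fun _ => κ) :=
  ⟨by fun_prop, Measure.map_infinitePi_infinitePi_of_inj hj⟩

theorem measurePreserving_smul_bernoulliMeasure (κ : Measure K) [IsProbabilityMeasure κ] (g : G) :
    MeasurePreserving (fun x : BernoulliSpace G K => g • x) (bernoulliMeasure G κ)
      (bernoulliMeasure G κ) :=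
  measurePreserving_comp_infinitePi κ (mul_right_injective g⁻¹)

/-- The automorphism of `G` is absorbed into the indexing of the target. -/
theorem ConjugateUpToAutomorphisms.exists_blockCode [Countable G] {κ₁ : Measure K₁}
    [IsProbabilityMeasure κ₁] {κ₂ : Measure K₂} [IsProbabilityMeasure κ₂]
    (h : ConjugateUpToAutomorphisms G G (bernoulliMeasure G κ₁) (bernoulliMeasure G κ₂)) :
    ∃ (ψ : (G → K₁) → K₂) (J : (G → K₂) → G → K₁), Measurable J ∧
      MeasurePreserving (blockCode (· * ·) ψ) (Measure.infinitePi fun _ : G => κ₁)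
        (Measure.infinitePi fun _ : G => κ₂) ∧
      ∀ᵐ z ∂Measure.infinitePi fun _ : G => κ₁, J (blockCode (· * ·) ψ z) = z := by
  have : Nonempty (BernoulliSpace G K₁) :=
    have := nonempty_of_isProbabilityMeasure κ₁
    inferInstanceAs (Nonempty (G → K₁))
  have : Nonempty (BernoulliSpace G K₂) :=
    have := nonempty_of_isProbabilityMeasure κ₂
    inferInstanceAs (Nonempty (G → K₂))
  obtain ⟨Φ, E, J, hE, hJ, hequiv, hJE⟩ :=
    h.exists_measurePreserving (measurePreserving_smul_bernoulliMeasure κ₁)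
  change (G → K₁) → G → K₂ at E
  change (G → K₂) → G → K₁ at J
  change MeasurePreserving E (Measure.infinitePi fun _ => κ₁) (Measure.infinitePi fun _ => κ₂) at hE
  let ψ (z : G → K₁) : K₂ := E z 1
  have hψ : Measurable ψ := (measurable_pi_apply 1).comp hE.measurable
  have hcode : ∀ᵐ z ∂Measure.infinitePi fun _ : G => κ₁,
      blockCode (· * ·) ψ z = fun g => E z (Φ g) := by
    filter_upwards [ae_all_iff.2 fun g => hequiv g⁻¹] with z hz
    refine funext fun g => ?_
    have hg : E (fun h => z (g⁻¹⁻¹ * h)) 1 = E z ((Φ g⁻¹)⁻¹ * 1) := congrFun (hz g) 1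
    rwa [map_inv, inv_inv, inv_inv, mul_one] at hg
  refine ⟨ψ, fun y => J fun g => y (Φ.symm g), ?_, ⟨measurable_blockCode _ hψ, ?_⟩, ?_⟩
  · exact Measurable.comp (g := J) hJ (by fun_prop)
  · rw [Measure.map_congr hcode]
    exact ((measurePreserving_comp_infinitePi κ₂ Φ.injective).comp hE).map_eq
  · filter_upwards [hcode, hJE] with z hz hJz
    simp only [hz, MulEquiv.apply_symm_apply]
    exact hJz

theorem measurePreserving_of_blockCode {κ₁ : Measure K₁} [IsProbabilityMeasure κ₁]
    {κ₂ : Measure K₂} [IsProbabilityMeasure κ₂] {ψ : (G → K₁) → K₂}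
    (h : MeasurePreserving (blockCode (· * ·) ψ) (Measure.infinitePi fun _ : G => κ₁)
      (Measure.infinitePi fun _ : G => κ₂)) :
    MeasurePreserving ψ (Measure.infinitePi fun _ : G => κ₁) κ₂ := by
  have h1 := (measurePreserving_eval_infinitePi (fun _ : G => κ₂) 1).comp h
  simpa only [Function.comp_def, blockCode, one_mul] using h1

end Conjugacy

/-! ### Comparison of the entropies of finite partitions -/

section Comparison

variable {G K A : Type*} [Group G] [MeasurableSpace K]

theorem measureReal_blockCode_ne_le {L : Type*} (κ : Measure K) [IsProbabilityMeasure κ]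
    {c c' : (G → K) → L}
    (hcc' : NullMeasurableSet {z | c z ≠ c' z} (Measure.infinitePi fun _ : G => κ))
    {T : Finset G} {d : (G → L) → A} (hd : DependsOn d (T : Set G)) :
    (Measure.infinitePi fun _ : G => κ).real
        {z | d (blockCode (· * ·) c z) ≠ d (blockCode (· * ·) c' z)} ≤
      T.card * (Measure.infinitePi fun _ : G => κ).real {z | c z ≠ c' z} := by
  set μ := Measure.infinitePi fun _ : G => κ
  have hshift (g : G) : μ.real {z | c (fun h => z (g * h)) ≠ c' fun h => z (g * h)} =
      μ.real {z | c z ≠ c' z} :=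
    (measurePreserving_comp_infinitePi κ (mul_right_injective g)).measureReal_preimage hcc'
  have hsub : {z | d (blockCode (· * ·) c z) ≠ d (blockCode (· * ·) c' z)} ⊆
      ⋃ g ∈ T, {z | c (fun h => z (g * h)) ≠ c' fun h => z (g * h)} := fun z hz => by
    by_contra hnot
    simp only [Set.mem_iUnion, not_exists, Set.mem_ofPred_eq, not_not] at hnot
    exact hz (hd fun g hg => hnot g hg)
  calc μ.real {z | d (blockCode (· * ·) c z) ≠ d (blockCode (· * ·) c' z)}
      ≤ μ.real (⋃ g ∈ T, {z | c (fun h => z (g * h)) ≠ c' fun h => z (g * h)}) :=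
        measureReal_mono hsub (measure_ne_top _ _)
    _ ≤ ∑ g ∈ T, μ.real {z | c (fun h => z (g * h)) ≠ c' fun h => z (g * h)} :=
        measureReal_biUnion_finset_le _ _
    _ = T.card * μ.real {z | c z ≠ c' z} := by
        simp only [hshift, Finset.sum_const, nsmul_eq_mul]

theorem measureReal_codingRecord_ne_le {B : Type*} (κ : Measure K) [IsProbabilityMeasure κ]
    (a : K → A) {c c' : (G → K) → B}
    (hcc' : NullMeasurableSet {z | c z ≠ c' z} (Measure.infinitePi fun _ : G => κ)) {T : Finset G}
    {d : (G → B) → A} (hd : DependsOn d (T : Set G)) :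
    (Measure.infinitePi fun _ : G => κ).real
        {z | codingRecord a c d z ≠ codingRecord a c' d z} ≤
      (1 + T.card) * (Measure.infinitePi fun _ : G => κ).real {z | c z ≠ c' z} := by
  set μ := Measure.infinitePi fun _ : G => κ
  have hsub : {z | codingRecord a c d z ≠ codingRecord a c' d z} ⊆ {z | c z ≠ c' z} ∪
      {z | d (blockCode (· * ·) c z) ≠ d (blockCode (· * ·) c' z)} := fun z hz => by
    simp only [codingRecord, Set.mem_union, Set.mem_ofPred_eq] at hz ⊢
    by_contra! h
    exact hz (by rw [h.1, h.2])
  calc μ.real {z | codingRecord a c d z ≠ codingRecord a c' d z}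
      ≤ μ.real {z | c z ≠ c' z} +
          μ.real {z | d (blockCode (· * ·) c z) ≠ d (blockCode (· * ·) c' z)} :=
        (measureReal_mono hsub (measure_ne_top _ _)).trans (measureReal_union_le _ _)
    _ ≤ μ.real {z | c z ≠ c' z} + T.card * μ.real {z | c z ≠ c' z} := by
        gcongr
        exact measureReal_blockCode_ne_le κ hcc' hd
    _ = (1 + T.card) * μ.real {z | c z ≠ c' z} := by ring

variable [Fintype A] [MeasurableSpace A] [MeasurableSingletonClass A]

theorem IsSofic.shannonEntropy_map_le_integral {B : Type*} [Fintype B] [MeasurableSpace B]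
    [MeasurableSingletonClass B] (κ : Measure K) [IsProbabilityMeasure κ] (hG : IsSofic G)
    {a : K → A} (ha : Measurable a) {c : (G → K) → B} (hc : Measurable c)
    {d : (G → B) → A} (hd : Measurable d) {T : Finset G} (hdT : DependsOn d (T : Set G))
    {w : B → ℝ} (hw : ∀ b, 0 < w b) (hw₁ : ∑ b, w b ≤ 1)
    {ρ : A → A → ℝ} (hρ : ∀ t s, 0 < ρ t s) (hρ₁ : ∀ t, ∑ s, ρ t s ≤ 1) :
    shannonEntropy (κ.map a) ≤
      ∫ z, codingCost w ρ (codingRecord a c d z) ∂Measure.infinitePi fun _ : G => κ := by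
  set μ := Measure.infinitePi fun _ : G => κ
  obtain ⟨C, hC₀, hC⟩ := exists_forall_sub_le_of_finite (codingCost w ρ)
  refine le_of_forall_pos_le_add fun ε hε => ?_
  obtain ⟨η, hη, hηε⟩ := exists_pos_mul_lt hε (C * (1 + T.card))
  obtain ⟨n, b, W, e, hb, he, heW, hclose⟩ := exists_finite_letters_measureReal_ne_lt μ hc hη
  let c' (z : G → K) : B := e fun g => b (z g)
  have hc' : Measurable c' := he.comp (by fun_prop)
  have hcW' : DependsOn c' W := fun z z' h => heW fun g hg => congrArg b (h g hg)
  calc shannonEntropy (κ.map a)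
      ≤ ∫ z, codingCost w ρ (codingRecord a c' d z) ∂μ :=
        hG.shannonEntropy_map_le_integral_of_dependsOn κ ha hc' hcW' W.finite_toSet hd hdT
          T.finite_toSet hw hw₁ hρ hρ₁
    _ ≤ ∫ z, codingCost w ρ (codingRecord a c d z) ∂μ +
          C * μ.real {z | codingRecord a c' d z ≠ codingRecord a c d z} :=
        integral_comp_le_add_measureReal_ne μ hC (measurable_codingRecord ha hc' hd)
          (measurable_codingRecord ha hc hd)
    _ ≤ ∫ z, codingCost w ρ (codingRecord a c d z) ∂μ + C * ((1 + T.card) * η) := by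
        gcongr
        refine (measureReal_codingRecord_ne_le κ a
          (measurableSet_eq_fun hc' hc).compl.nullMeasurableSet hdT).trans ?_
        gcongr
    _ ≤ ∫ z, codingCost w ρ (codingRecord a c d z) ∂μ + ε := by
        rw [← mul_assoc]
        gcongr

variable {K₁ K₂ : Type*} [MeasurableSpace K₁] [MeasurableSpace K₂]

theorem exists_finite_letters_integral_neg_log_le {ι : Type*} (μ : Measure (ι → K))
    [IsProbabilityMeasure μ] {g : (ι → K) → A} (hg : Measurable g) {ε : ℝ} (hε : 0 < ε) :
    ∃ ρ : A → A → ℝ, (∀ t s, 0 < ρ t s) ∧ (∀ t, ∑ s, ρ t s ≤ 1) ∧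
      ∃ (n : ℕ) (b : K → Fin n) (T : Finset ι) (d : (ι → Fin n) → A), Measurable b ∧
        Measurable d ∧ DependsOn d (T : Set ι) ∧
        ∫ x, -Real.log (ρ (d fun i => b (x i)) (g x)) ∂μ ≤ ε := by
  classical
  let ρ (t s : A) : ℝ := smoothing (ε / 2) (Pi.single t 1) s
  have hsingle (t : A) : 0 ≤ (Pi.single t 1 : A → ℝ) := Pi.single_nonneg.2 zero_le_one
  have hdiag (t : A) : -Real.log (ρ t t) ≤ ε / 2 :=
    (neg_log_smoothing_le (by positivity) (by simp)).trans_eq (by simp)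
  -- A wrong prediction is rare, and smoothing bounds its cost.
  obtain ⟨C, hC₀, hC⟩ := exists_forall_sub_le_of_finite fun r : A × A => -Real.log (ρ r.1 r.2)
  obtain ⟨η, hη, hηε⟩ := exists_pos_mul_lt (half_pos hε) C
  obtain ⟨n, b, T, d, hb, hd, hdT, hclose⟩ := exists_finite_letters_measureReal_ne_lt μ hg hη
  refine ⟨ρ, fun t s => smoothing_pos (by positivity) (hsingle t) s,
    fun t => sum_smoothing_le_one (by positivity) (by simp), n, b, T, d, hb, hd, hdT, ?_⟩
  calc ∫ x, -Real.log (ρ (d fun i => b (x i)) (g x)) ∂μ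
      ≤ ∫ x, -Real.log (ρ (g x) (g x)) ∂μ
          + C * μ.real {x | (d (fun i => b (x i)), g x) ≠ (g x, g x)} :=
        integral_comp_le_add_measureReal_ne μ (u := fun r : A × A => -Real.log (ρ r.1 r.2)) hC
          (Y := fun x => (d (fun i => b (x i)), g x))
          (Y' := fun x => (g x, g x)) ((hd.comp (by fun_prop)).prodMk hg) (hg.prodMk hg)
    _ ≤ ε / 2 + C * η := by
        simp only [ne_eq, Prod.mk.injEq, and_true]
        gcongr
        exact integral_comp_le_of_forall_le hdiag hg
    _ ≤ ε := by linarith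

theorem integral_codingCost_eq_of_blockCode {A B : Type*} [Finite A] [MeasurableSpace A]
    [MeasurableSingletonClass A] [Finite B] [MeasurableSpace B] [MeasurableSingletonClass B]
    {κ₁ : Measure K₁} [IsProbabilityMeasure κ₁] {κ₂ : Measure K₂}
    [IsProbabilityMeasure κ₂] {ψ : (G → K₁) → K₂} {J : (G → K₂) → G → K₁} (hJ : Measurable J)
    (hcode : MeasurePreserving (blockCode (· * ·) ψ) (Measure.infinitePi fun _ : G => κ₁)
      (Measure.infinitePi fun _ : G => κ₂))
    (hinv : ∀ᵐ z ∂Measure.infinitePi fun _ : G => κ₁, J (blockCode (· * ·) ψ z) = z)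
    {a : K₁ → A} (ha : Measurable a) {b : K₂ → B} (hb : Measurable b) {d : (G → B) → A}
    (hd : Measurable d) (w : B → ℝ) (ρ : A → A → ℝ) :
    ∫ z, codingCost w ρ (codingRecord a (fun z => b (ψ z)) d z)
        ∂(Measure.infinitePi fun _ : G => κ₁) =
      ∫ i, -Real.log (w i) ∂κ₂.map b +
        ∫ y, -Real.log (ρ (d fun g => b (y g)) (a (J y 1)))
          ∂Measure.infinitePi fun _ : G => κ₂ := by
  have hψ := measurePreserving_of_blockCode hcode
  let u (r : A × A) : ℝ := -Real.log (ρ r.1 r.2)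
  let guess (y : G → K₂) : A × A := (d fun g => b (y g), a (J y 1))
  have hguess : Measurable guess :=
    (hd.comp (by fun_prop)).prodMk (ha.comp ((measurable_pi_apply 1).comp hJ))
  have hsplit : (fun z => codingCost w ρ (codingRecord a (fun z => b (ψ z)) d z)) =ᵐ[
      Measure.infinitePi fun _ : G => κ₁]
      fun z => -Real.log (w (b (ψ z))) + u (guess (blockCode (· * ·) ψ z)) := by
    filter_upwards [hinv] with z hz
    simp only [codingCost, codingRecord, sub_eq_add_neg, u, guess, hz]
    rfl
  rw [← integral_comp_of_measurePreserving hcode u hguess,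
    integral_map_of_finite κ₂ (fun i => -Real.log (w i)) hb,
    ← integral_comp_of_measurePreserving hψ (fun i => -Real.log (w i)) hb]
  exact (integral_congr_ae hsplit).trans (integral_add
    (integrable_comp_of_finite _ (fun i => -Real.log (w i)) (hb.comp hψ.measurable))
    (integrable_comp_of_finite _ u (hguess.comp hcode.measurable)))

theorem IsSofic.exists_shannonEntropy_map_le_of_conjugate [Countable G] (hG : IsSofic G)
    {κ₁ : Measure K₁} [IsProbabilityMeasure κ₁] {κ₂ : Measure K₂} [IsProbabilityMeasure κ₂]
    (hconj : ConjugateUpToAutomorphisms G G (bernoulliMeasure G κ₁) (bernoulliMeasure G κ₂))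
    {a : K₁ → A} (ha : Measurable a) {ε : ℝ} (hε : 0 < ε) :
    ∃ (n : ℕ) (b : K₂ → Fin n), Measurable b ∧
      shannonEntropy (κ₁.map a) ≤ shannonEntropy (κ₂.map b) + ε := by
  obtain ⟨ψ, J, hJ, hcode, hinv⟩ := hconj.exists_blockCode
  have hψ := (measurePreserving_of_blockCode hcode).measurable
  have hg : Measurable fun y : G → K₂ => a (J y 1) := ha.comp ((measurable_pi_apply 1).comp hJ)
  obtain ⟨ρ, hρ, hρ₁, n, b, T, d, hb, hd, hdT, hρcost⟩ :=
    exists_finite_letters_integral_neg_log_le (Measure.infinitePi fun _ : G => κ₂) hg (half_pos hε)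
  have := Measure.isProbabilityMeasure_map (μ := κ₂) hb.aemeasurable
  let w : Fin n → ℝ := smoothing (ε / 2) fun i => (κ₂.map b).real {i}
  have hw : ∀ i, 0 < w i := smoothing_pos (half_pos hε) fun _ => measureReal_nonneg
  have hw₁ : ∑ i, w i ≤ 1 := sum_smoothing_le_one (half_pos hε).le (by simp)
  refine ⟨n, b, hb, ?_⟩
  calc shannonEntropy (κ₁.map a)
      ≤ ∫ z, codingCost w ρ (codingRecord a (fun z => b (ψ z)) d z)
          ∂Measure.infinitePi fun _ : G => κ₁ :=
        hG.shannonEntropy_map_le_integral κ₁ ha (hb.comp hψ) hd hdT hw hw₁ hρ hρ₁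
    _ = ∫ i, -Real.log (w i) ∂κ₂.map b + ∫ y, -Real.log (ρ (d fun g => b (y g)) (a (J y 1)))
          ∂Measure.infinitePi fun _ : G => κ₂ :=
        integral_codingCost_eq_of_blockCode hJ hcode hinv ha hb hd w ρ
    _ ≤ (shannonEntropy (κ₂.map b) + ε / 2) + ε / 2 :=
        add_le_add (integral_neg_log_smoothing_le _ (half_pos hε).le) hρcost
    _ = shannonEntropy (κ₂.map b) + ε := by ring

end Comparison

/-! ### Entropy as a supremum over finite partitions -/

section BaseEntropy

/-- The information content `-log t ∈ [0, ∞]` of an event of probability `t`, so that the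
entropy of a probability measure is the mean information of its points, diffuse measures having
entropy `∞`. -/
noncomputable def information (t : ℝ≥0∞) : ℝ≥0∞ :=
  (-ENNReal.log t).toENNReal

theorem information_zero : information 0 = ⊤ := by
  simp [information]

theorem antitone_information : Antitone information := fun _ _ hst =>
  EReal.toENNReal_le_toENNReal (EReal.neg_le_neg_iff.2 (ENNReal.log_monotone hst))

theorem continuous_information : Continuous information :=
  EReal.continuous_toENNReal.comp (continuous_neg.comp ENNReal.continuous_log)

theorem mul_information {t : ℝ≥0∞} (ht : t ≠ ⊤) :
    t * information t = ENNReal.ofReal (Real.negMulLog t.toReal) := by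
  rcases eq_or_ne t 0 with rfl | ht₀
  · simp
  · have hlog : -ENNReal.log t = ((-Real.log t.toReal : ℝ) : EReal) := by
      rw [ENNReal.log_pos_real ht₀ ht, EReal.coe_neg]
    rw [information, hlog, EReal.toENNReal_of_ne_top (EReal.coe_ne_top _), EReal.toReal_coe,
      ← ENNReal.ofReal_toReal ht, ← ENNReal.ofReal_mul ENNReal.toReal_nonneg,
      ENNReal.toReal_ofReal ENNReal.toReal_nonneg, Real.negMulLog, mul_neg, neg_mul]

variable {K : Type*} [MeasurableSpace K] {κ : Measure K} [IsProbabilityMeasure κ]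

theorem ofReal_shannonEntropy_map_eq_lintegral {A : Type*} [Fintype A] [MeasurableSpace A]
    [MeasurableSingletonClass A] {b : K → A} (hb : Measurable b) :
    ENNReal.ofReal (shannonEntropy (κ.map b)) = ∫⁻ k, information (κ (b ⁻¹' {b k})) ∂κ := by
  have := Measure.isProbabilityMeasure_map (μ := κ) hb.aemeasurable
  calc ENNReal.ofReal (shannonEntropy (κ.map b))
      = ∑ a, ENNReal.ofReal (Real.negMulLog ((κ.map b).real {a})) :=
        ENNReal.ofReal_sum_of_nonneg fun _ _ =>
          Real.negMulLog_nonneg measureReal_nonneg measureReal_le_one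
    _ = ∑ a, information (κ.map b {a}) * κ.map b {a} :=
        Finset.sum_congr rfl fun a _ => by
          rw [mul_comm, mul_information (measure_ne_top _ _), Measure.real]
    _ = ∫⁻ a, information (κ.map b {a}) ∂κ.map b := (lintegral_fintype _).symm
    _ = ∫⁻ k, information (κ.map b {b k}) ∂κ := lintegral_map (.of_discrete) hb
    _ = ∫⁻ k, information (κ (b ⁻¹' {b k})) ∂κ := by
        simp only [Measure.map_apply hb (measurableSet_singleton _)]

theorem baseEntropy_eq_lintegral [MeasurableSingletonClass K] :
    baseEntropy κ = ∫⁻ k, information (κ {k}) ∂κ := by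
  by_cases hκ : ∃ K' : Set K, K'.Countable ∧ κ K' = 1
  · obtain ⟨K', hK', h1⟩ := hκ
    have hcarrier : ∀ᵐ k ∂κ, k ∈ K' := (prob_compl_eq_zero_iff hK'.measurableSet).2 h1
    calc baseEntropy κ
        = ∑' k : K', information (κ {(k : K)}) * κ {(k : K)} := by
          rw [baseEntropy_eq_tsum κ K' hK' h1]
          refine tsum_congr fun k => ?_
          rw [mul_comm, mul_information (measure_ne_top _ _), Measure.real]
      _ = ∫⁻ k in K', information (κ {k}) ∂κ :=
          (lintegral_countable (fun k => information (κ {k})) hK').symm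
      _ = ∫⁻ k, information (κ {k}) ∂κ := by rw [Measure.restrict_eq_self_of_ae_mem hcarrier]
  · have hatoms : {k | 0 < κ {k}}.Countable := Measure.countable_meas_level_set_pos measurable_id
    have hdiffuse : κ {k | 0 < κ {k}}ᶜ ≠ 0 := fun h0 =>
      hκ ⟨_, hatoms, (prob_compl_eq_zero_iff hatoms.measurableSet).1 h0⟩
    have htop : ∫⁻ k in {k | 0 < κ {k}}ᶜ, information (κ {k}) ∂κ = ⊤ := by
      rw [setLIntegral_congr_fun hatoms.measurableSet.compl (g := fun _ => ⊤) fun k hk => ?_,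
        setLIntegral_const, ENNReal.top_mul hdiffuse]
      have hk₀ : κ {k} = 0 := by simpa using hk
      rw [hk₀, information_zero]
    rw [baseEntropy, if_neg hκ]
    exact (top_le_iff.1 (htop.ge.trans (setLIntegral_le_lintegral _ _))).symm

theorem ofReal_shannonEntropy_map_le_baseEntropy [MeasurableSingletonClass K] {A : Type*}
    [Fintype A] [MeasurableSpace A] [MeasurableSingletonClass A] {b : K → A}
    (hb : Measurable b) : ENNReal.ofReal (shannonEntropy (κ.map b)) ≤ baseEntropy κ := by
  rw [ofReal_shannonEntropy_map_eq_lintegral hb, baseEntropy_eq_lintegral]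
  exact lintegral_mono fun k => antitone_information (measure_mono (by simp))

theorem baseEntropy_le_of_forall_ofReal_shannonEntropy_map_le
    [MeasurableSpace.CountablySeparated K] {C : ℝ≥0∞}
    (hC : ∀ n (b : K → Fin n → Bool), Measurable b →
      ENNReal.ofReal (shannonEntropy (κ.map b)) ≤ C) :
    baseEntropy κ ≤ C := by
  obtain ⟨f, hf, hf_inj⟩ := MeasurableSpace.measurable_injection_nat_bool_of_countablySeparated K
  let b (n : ℕ) (k : K) (i : Fin n) : Bool := f k i
  have hb (n : ℕ) : Measurable (b n) :=
    measurable_pi_lambda _ fun i => (measurable_pi_apply (i : ℕ)).comp hf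
  have hcell_anti (k : K) : Antitone fun n => b n ⁻¹' {b n k} := fun m n hmn k' hk' =>
    funext fun i => congrFun hk' (i.castLE hmn)
  have hcell_inter (k : K) : ⋂ n, b n ⁻¹' {b n k} = {k} := by
    ext k'
    refine ⟨fun hk' => hf_inj (funext fun i => ?_), fun hk' => by simp_all⟩
    exact congrFun (Set.mem_iInter.1 hk' (i + 1)) (Fin.last i)
  have hcell_mono (k : K) : Monotone fun n => information (κ (b n ⁻¹' {b n k})) :=
    fun _ _ hmn =>
    antitone_information (measure_mono (hcell_anti k hmn))
  have hcell_tendsto (k : K) : Tendsto (fun n => information (κ (b n ⁻¹' {b n k}))) atTop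
      (𝓝 (information (κ {k}))) := by
    rw [← hcell_inter k]
    exact (continuous_information.tendsto _).comp (tendsto_measure_iInter_atTop
      (fun n => (hb n (measurableSet_singleton _)).nullMeasurableSet) (hcell_anti k)
      ⟨0, measure_ne_top _ _⟩)
  have hmeas (n : ℕ) : AEMeasurable (fun k => information (κ (b n ⁻¹' {b n k}))) κ :=
    ((measurable_of_finite fun a => information (κ (b n ⁻¹' {a}))).comp (hb n)).aemeasurable
  have := MeasurableSpace.measurableSingletonClass_of_countablySeparated (α := K)
  rw [baseEntropy_eq_lintegral]
  refine le_of_tendsto' (lintegral_tendsto_of_tendsto_of_monotone hmeas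
    (ae_of_all _ hcell_mono) (ae_of_all _ hcell_tendsto)) fun n => ?_
  rw [← ofReal_shannonEntropy_map_eq_lintegral (hb n)]
  exact hC n _ (hb n)

end BaseEntropy

section Main

variable {G K₁ K₂ : Type*} [Group G] [Countable G] [MeasurableSpace K₁] [MeasurableSpace K₂]
  [MeasurableSpace.CountablySeparated K₁] {κ₁ : Measure K₁} [IsProbabilityMeasure κ₁]
  {κ₂ : Measure K₂} [IsProbabilityMeasure κ₂]

theorem IsSofic.baseEntropy_le_of_conjugate [MeasurableSingletonClass K₂] (hG : IsSofic G)
    (hconj : ConjugateUpToAutomorphisms G G (bernoulliMeasure G κ₁) (bernoulliMeasure G κ₂)) :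
    baseEntropy κ₁ ≤ baseEntropy κ₂ := by
  refine baseEntropy_le_of_forall_ofReal_shannonEntropy_map_le fun n a ha =>
    ENNReal.le_of_forall_pos_le_add fun ε hε _ => ?_
  obtain ⟨m, b, hb, hab⟩ := hG.exists_shannonEntropy_map_le_of_conjugate hconj ha hε
  have := Measure.isProbabilityMeasure_map (μ := κ₂) hb.aemeasurable
  calc ENNReal.ofReal (shannonEntropy (κ₁.map a))
      ≤ ENNReal.ofReal (shannonEntropy (κ₂.map b) + ε) := ENNReal.ofReal_le_ofReal hab
    _ = ENNReal.ofReal (shannonEntropy (κ₂.map b)) + ε := by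
        rw [ENNReal.ofReal_add (shannonEntropy_nonneg _) ε.coe_nonneg, ENNReal.ofReal_coe_nnreal]
    _ ≤ baseEntropy κ₂ + ε := by
        gcongr
        exact ofReal_shannonEntropy_map_le_baseEntropy hb

theorem mainTheorem6_general [MeasurableSpace.CountablySeparated K₂] (hG : IsSofic G)
    (hconj : ConjugateUpToAutomorphisms G G (bernoulliMeasure G κ₁) (bernoulliMeasure G κ₂)) :
    baseEntropy κ₁ = baseEntropy κ₂ := by
  have := MeasurableSpace.measurableSingletonClass_of_countablySeparated (α := K₁)
  have := MeasurableSpace.measurableSingletonClass_of_countablySeparated (α := K₂)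
  exact le_antisymm (hG.baseEntropy_le_of_conjugate hconj)
    (hG.baseEntropy_le_of_conjugate hconj.symm)

end Main

theorem mainTheorem6 {G : Type*} [Group G] [Countable G] (hG : IsSofic G)
    {K₁ K₂ : Type*} [MeasurableSpace K₁] [StandardBorelSpace K₁]
    [MeasurableSpace K₂] [StandardBorelSpace K₂]
    (κ₁ : Measure K₁) [IsProbabilityMeasure κ₁] (κ₂ : Measure K₂) [IsProbabilityMeasure κ₂]
    (hfin : baseEntropy κ₁ + baseEntropy κ₂ < ⊤)
    (hconj : ConjugateUpToAutomorphisms G G (bernoulliMeasure G κ₁) (bernoulliMeasure G κ₂)) :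
    baseEntropy κ₁ = baseEntropy κ₂ :=
  mainTheorem6_general hG hconj
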